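/- Let $\mathfrak B$ be a real or complex Banach space with norm $|\cdot|$. Let $C(\mathbb R,\mathfrak B)$ be the space of continuous functions $\mathbb R\to\mathfrak B$ with the topology of uniform convergence on compact sets, and for $h\in\mathbb R$ let $\varphi^h(t):=\varphi(t+h)$. A function $\varphi\in C(\mathbb R,\mathfrak B)$ is called - positively Lagrange stable if $\{\varphi^h : h\ge 0\}$ is relatively compact in $C(\mathbb R,\mathfrak B)$; - positively remotely almost periodic if for every $\varepsilon>0$ there is a relatively dense set $\mathcal P\subseteq\mathbb R$ (i.e. for some $l>0$ every interval $[a,a+l]$, $a\in\mathbb R$, meets $\mathcal P$) such that for every $\tau\in\mathcal P$ there is $L>0$ with $|\varphi(t+\tau)-\varphi(t)|<\varepsilon$ for all $t\ge L$; - positively remotely $\tau$-periodic ($\tau>0$) if $\lim_{t\to+\infty}|\varphi(t+\tau)-\varphi(t)|=0$; - positively remotely stationary if it is positively remotely $\tau$-periodic for every $\tau>0$. The $\omega$-limit set $\omega_\varphi$ is the set of all limits in $C(\mathbb R,\mathfrak B)$ of sequences $\varphi^{t_k}$ with $t_k\ge 0$, $t_k\to+\infty$. A set $M\subseteq C(\mathbb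 R,\mathfrak B)$ is invariant if $\{\psi^t:\psi\in M\}=M$ for all $t\in\mathbb R$, and minimal if it is nonempty, closed and invariant and has no proper subset which is nonempty, closed and invariant. **Corollary 3.8.** Let $\varphi\in C(\mathbb R,\mathfrak B)$ be positively Lagrange stable. Assume that 1. $\varphi$ is positively remotely almost periodic (respectively, positively remotely $\tau$-periodic for a given $\tau>0$, or positively remotely stationary), and its $\omega$-limit set $\omega_\varphi$ is minimal; 2. the primitive $F(t):=\int_0^t\varphi(s)\,ds$ is precompact, i.e. $\overline{F(\mathbb R_+)}$ is a compact subset of $\mathfrak B$, where $\mathbb R_+:=[0,+\infty)$. Then the primitive $F$ is positively remotely almost periodic (respectively, positively remotely $\tau$-periodic, or positively remotely stationary). -/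

import Mathlib

open Filter Topology

noncomputable section

namespace RemotelyAP

variable {B : Type*} [NormedAddCommGroup B]

/-- The translation `φ^h(t) = φ(t + h)`, the action at time `h` of the shift (Bebutov) dynamical
system on `C(ℝ, B)`. The space `C(ℝ, B)` carries the compact-open topology, i.e. that of uniform
convergence on compact sets. -/
def shift (h : ℝ) (φ : C(ℝ, B)) : C(ℝ, B) where
  toFun t := φ (t + h)
  continuous_toFun := by fun_prop

/-- The positive semi-trajectory `{φ^h | h ≥ 0}` is precompact in `C(ℝ, B)`. -/
def PositivelyLagrangeStable (φ : C(ℝ, B)) : Prop :=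
  IsCompact (closure {ψ : C(ℝ, B) | ∃ h : ℝ, 0 ≤ h ∧ ψ = shift h φ})

/-- The `ω`-limit set of `φ` in the shift dynamical system: the limits of sequences `φ^{t_k}` with
`t_k ≥ 0` and `t_k → +∞`. -/
def omegaLimitSet (φ : C(ℝ, B)) : Set C(ℝ, B) :=
  {ψ | ∃ t : ℕ → ℝ, (∀ k, 0 ≤ t k) ∧ Tendsto t atTop atTop ∧
    Tendsto (fun k => shift (t k) φ) atTop (𝓝 ψ)}

/-- `M` is invariant under the shift dynamical system: `σ(t, M) = M` for all `t ∈ ℝ`. -/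
def ShiftInvariant (M : Set C(ℝ, B)) : Prop :=
  ∀ t : ℝ, shift t '' M = M

/-- `M` is a minimal set of the shift dynamical system: it is nonempty, closed and invariant, and
has no proper subset with these three properties. -/
def IsMinimalShiftSet (M : Set C(ℝ, B)) : Prop :=
  M.Nonempty ∧ IsClosed M ∧ ShiftInvariant M ∧
    ∀ N : Set C(ℝ, B), N ⊆ M → N.Nonempty → IsClosed N → ShiftInvariant N → N = M

/-- `A` is relatively dense in `ℝ`. -/
def RelativelyDense (A : Set ℝ) : Prop :=
  ∃ l : ℝ, 0 < l ∧ ∀ a : ℝ, (A ∩ Set.Icc a (a + l)).Nonempty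

/-- For every `ε > 0` there is a relatively dense set of `τ`, for each of which
`|φ(t + τ) - φ(t)| < ε` for all `t ≥ L`, where `L > 0` may depend on `ε` and on `τ`. -/
def PositivelyRemotelyAlmostPeriodic (φ : C(ℝ, B)) : Prop :=
  ∀ ε : ℝ, 0 < ε → ∃ P : Set ℝ, RelativelyDense P ∧
    ∀ τ ∈ P, ∃ L : ℝ, 0 < L ∧ ∀ t : ℝ, L ≤ t → ‖φ (t + τ) - φ t‖ < ε

/-- `|φ(t + τ) - φ(t)| → 0` as `t → +∞`. -/
def PositivelyRemotelyPeriodic (τ : ℝ) (φ : C(ℝ, B)) : Prop :=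
  Tendsto (fun t : ℝ => ‖φ (t + τ) - φ t‖) atTop (𝓝 0)

/-- `φ` is remotely `τ`-periodic for every `τ > 0`. -/
def PositivelyRemotelyStationary (φ : C(ℝ, B)) : Prop :=
  ∀ τ : ℝ, 0 < τ → PositivelyRemotelyPeriodic τ φ

/-- The primitive `F(t) = ∫₀ᵗ φ(s) ds`. -/
def primitive [NormedSpace ℝ B] (φ : C(ℝ, B)) : C(ℝ, B) where
  toFun t := ∫ s in (0 : ℝ)..t, φ s
  continuous_toFun :=
    intervalIntegral.continuous_primitive (fun a b => φ.continuous.intervalIntegrable a b) 0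

end RemotelyAP

end

noncomputable section

namespace RemotelyAP

section Shift

variable {B : Type*} [NormedAddCommGroup B]

/-! The pair (φ^t, F(t)) is the trajectory of (φ, 0) under the skew product flow (ψ, x) ↦ (ψ^s, x +
∫₀ˢ ψ). It is precompact, so its ω-limit set contains a compact minimal set M. Fibre translations
commute with the flow, so M meets each fibre at most once (`eq_of_mem_minimal`); minimality of ω_φ
makes M project onto ω_φ. Thus M is the graph of a function on ω_φ, uniformly continuous for the sup
distance (`exists_norm_sub_lt_of_graph`). If τ is a remote δ-almost period of φ, then ψ^τ is δ-close
to ψ on all of ℝ for ψ ∈ ω_φ, hence ∫₀^τ ψ is small. Compactness carries this bound back to F(t + τ)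
- F(t) = ∫₀^τ φ^t for large t. -/

@[simp]
theorem shift_apply (h : ℝ) (φ : C(ℝ, B)) (t : ℝ) : shift h φ t = φ (t + h) := rfl

theorem shift_shift (s t : ℝ) (φ : C(ℝ, B)) : shift s (shift t φ) = shift (t + s) φ := by
  ext r
  simp only [shift_apply, add_assoc, add_comm s t]

theorem shift_neg_shift (s : ℝ) (φ : C(ℝ, B)) : shift s (shift (-s) φ) = φ := by
  ext r
  simp

theorem continuous_shift (h : ℝ) : Continuous (shift h : C(ℝ, B) → C(ℝ, B)) :=
  ContinuousMap.continuous_precomp (⟨fun t => t + h, by fun_prop⟩ : C(ℝ, ℝ))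

/-- A set stable under all shifts is invariant, because the shifts form a group. -/
theorem shiftInvariant_of_forall_mem {M : Set C(ℝ, B)} (hM : ∀ s, ∀ ψ ∈ M, shift s ψ ∈ M) :
    ShiftInvariant M := by
  refine fun s => Set.Subset.antisymm ?_ fun ψ hψ => ⟨shift (-s) ψ, hM _ _ hψ, shift_neg_shift s ψ⟩
  rintro _ ⟨ψ, hψ, rfl⟩
  exact hM s ψ hψ

theorem mem_omegaLimitSet_of_mapClusterPt {φ ψ : C(ℝ, B)}
    (h : MapClusterPt ψ atTop fun t => shift t φ) : ψ ∈ omegaLimitSet φ := by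
  obtain ⟨u, hu, hu'⟩ := h.exists_seq_tendsto
  obtain ⟨N, hN⟩ := eventually_atTop.1 (hu'.eventually_ge_atTop 0)
  exact ⟨fun k => u (k + N), fun k => hN _ (Nat.le_add_left N k),
    hu'.comp (tendsto_add_atTop_nat N), hu.comp (tendsto_add_atTop_nat N)⟩

/-- Shifting by `u k → ∞` pushes the half-line where the bound holds out to all of ℝ. -/
theorem norm_sub_le_of_mem_omegaLimitSet {φ ψ : C(ℝ, B)} (hψ : ψ ∈ omegaLimitSet φ) {τ δ : ℝ}
    (h : ∀ᶠ t in atTop, ‖φ (t + τ) - φ t‖ ≤ δ) (s : ℝ) : ‖ψ (s + τ) - ψ s‖ ≤ δ := by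
  obtain ⟨u, -, hu, hlim⟩ := hψ
  have key (r : ℝ) : Tendsto (fun k => φ (r + u k)) atTop (𝓝 (ψ r)) :=
    ((continuous_eval_const r).tendsto ψ).comp hlim
  refine le_of_tendsto ((key (s + τ)).sub (key s)).norm ?_
  filter_upwards [(tendsto_atTop_add_const_left atTop s hu).eventually h] with k hk
  rwa [add_right_comm]

/-- A compact set that meets every fibre in at most one point is the graph of a function that is
uniformly continuous for the supremum distance. -/
theorem exists_norm_sub_lt_of_graph {M : Set (C(ℝ, B) × B)} (hM : IsCompact M)
    (hgraph : ∀ ψ x y, (ψ, x) ∈ M → (ψ, y) ∈ M → x = y) {ε : ℝ} (hε : 0 < ε) :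
    ∃ δ : ℝ, 0 < δ ∧ ∀ p ∈ M, ∀ q ∈ M, (∀ t, ‖p.1 t - q.1 t‖ ≤ δ) → ‖p.2 - q.2‖ < ε := by
  -- Pairs violating the claim for `δ`. These sets shrink with `δ`, and a pair in `M ×ˢ M` lying in
  -- all of them would have equal first components but distinct second ones; compactness makes a
  -- single one miss `M ×ˢ M`.
  let S : {δ : ℝ // 0 < δ} → Set ((C(ℝ, B) × B) × (C(ℝ, B) × B)) := fun δ =>
    {r | (∀ t, ‖r.1.1 t - r.2.1 t‖ ≤ δ) ∧ ε ≤ ‖r.1.2 - r.2.2‖}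
  have : Nonempty {δ : ℝ // 0 < δ} := ⟨⟨1, one_pos⟩⟩
  obtain ⟨δ, hδ⟩ := (hM.prod hM).elim_directed_family_closed S
    (fun δ => by
      have hsnd : Continuous fun r : (C(ℝ, B) × B) × (C(ℝ, B) × B) => ‖r.1.2 - r.2.2‖ := by
        fun_prop
      have hfst (t : ℝ) :
          Continuous fun r : (C(ℝ, B) × B) × (C(ℝ, B) × B) => ‖r.1.1 t - r.2.1 t‖ := by
        fun_prop
      have hS : S δ = (⋂ t, {r | ‖r.1.1 t - r.2.1 t‖ ≤ δ}) ∩ {r | ε ≤ ‖r.1.2 - r.2.2‖} := by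
        ext r
        simp [S]
      rw [hS]
      exact (isClosed_iInter fun t => isClosed_le (hfst t) continuous_const).inter
        (isClosed_le continuous_const hsnd))
    (by
      refine Set.eq_empty_of_forall_notMem ?_
      rintro ⟨⟨ψ, x⟩, ⟨χ, y⟩⟩ ⟨⟨hx, hy⟩, h⟩
      rw [Set.mem_iInter] at h
      have hψχ : ψ = χ := by
        ext t
        refine sub_eq_zero.1 (norm_le_zero_iff.1 (le_of_forall_pos_le_add fun δ hδ => ?_))
        simpa using (h ⟨δ, hδ⟩).1 t
      subst hψχ
      have hxy : x = y := hgraph _ _ _ hx hy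
      subst hxy
      have := (h ⟨1, one_pos⟩).2
      simp only [sub_self, norm_zero] at this
      exact absurd this (not_le.2 hε))
    (Monotone.directed_ge fun δ δ' hle r hr => ⟨fun t => (hr.1 t).trans hle, hr.2⟩)
  refine ⟨δ, δ.2, fun p hp q hq h => ?_⟩
  by_contra hlt
  exact (Set.eq_empty_iff_forall_notMem.1 hδ) (p, q) ⟨⟨hp, hq⟩, h, not_lt.1 hlt⟩

end Shift

section SkewShift

variable {B : Type*} [NormedAddCommGroup B] [NormedSpace ℝ B]

theorem continuous_primitive_apply (s : ℝ) : Continuous fun ψ : C(ℝ, B) => primitive ψ s :=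
  intervalIntegral.continuous_parametric_intervalIntegral_of_continuous'
    (f := fun (ψ : C(ℝ, B)) t => ψ t) ContinuousEval.continuous_eval 0 s

theorem primitive_shift (s t : ℝ) (ψ : C(ℝ, B)) :
    primitive (shift t ψ) s = primitive ψ (t + s) - primitive ψ t := by
  simp only [primitive, ContinuousMap.coe_mk, shift_apply]
  rw [intervalIntegral.integral_comp_add_right (fun x => ψ x), zero_add, add_comm s t,
    intervalIntegral.integral_interval_sub_left] <;> exact ψ.continuous.intervalIntegrable _ _

/-- The skew product extension of the shift flow by the primitive:
`(ψ, x) ↦ (ψ^s, x + ∫₀ˢ ψ)`. -/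
def skewShift (s : ℝ) (p : C(ℝ, B) × B) : C(ℝ, B) × B :=
  (shift s p.1, p.2 + primitive p.1 s)

theorem continuous_skewShift (s : ℝ) :
    Continuous (skewShift s : C(ℝ, B) × B → C(ℝ, B) × B) :=
  ((continuous_shift s).comp continuous_fst).prodMk
    (continuous_snd.add ((continuous_primitive_apply s).comp continuous_fst))

/-- The trajectory of `(φ, 0)` under the skew product flow. -/
def skewOrbit (φ : C(ℝ, B)) (t : ℝ) : C(ℝ, B) × B :=
  (shift t φ, primitive φ t)

theorem skewShift_skewOrbit (φ : C(ℝ, B)) (s t : ℝ) :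
    skewShift s (skewOrbit φ t) = skewOrbit φ (t + s) := by
  simp [skewShift, skewOrbit, shift_shift, primitive_shift]

theorem mapClusterPt_skewShift {φ : C(ℝ, B)} {p : C(ℝ, B) × B}
    (hp : MapClusterPt p atTop (skewOrbit φ)) (s : ℝ) :
    MapClusterPt (skewShift s p) atTop (skewOrbit φ) := by
  have h := hp.continuousAt_comp (continuous_skewShift s).continuousAt
  have h' : skewShift s ∘ skewOrbit φ = skewOrbit φ ∘ fun t => t + s :=
    funext fun t => skewShift_skewOrbit φ s t
  rw [h'] at h
  exact h.of_comp (tendsto_atTop_add_const_right atTop s tendsto_id)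

/-- The nonempty closed subsets of `E` that are stable under the skew product flow. -/
def skewInvariantSubsets (E : Set (C(ℝ, B) × B)) : Set (Set (C(ℝ, B) × B)) :=
  {M | M ⊆ E ∧ M.Nonempty ∧ IsClosed M ∧ ∀ s, ∀ p ∈ M, skewShift s p ∈ M}

theorem exists_minimal_skewInvariantSubsets {E : Set (C(ℝ, B) × B)} (hE : IsCompact E)
    (hmem : E ∈ skewInvariantSubsets E) : ∃ M, Minimal (· ∈ skewInvariantSubsets E) M := by
  obtain ⟨M, -, hM⟩ := zorn_superset_nonempty (skewInvariantSubsets E) (fun c hc hchain hne => by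
    refine ⟨⋂₀ c, ⟨?_, ?_, isClosed_sInter fun M hM => (hc hM).2.2.1, ?_⟩,
      fun M hM => Set.sInter_subset_of_mem hM⟩
    · obtain ⟨M, hM⟩ := hne
      exact (Set.sInter_subset_of_mem hM).trans (hc hM).1
    · have := hne.to_subtype
      exact IsCompact.nonempty_sInter_of_directed_nonempty_isCompact_isClosed
        (show IsChain (· ⊇ ·) c from hchain.symm).directedOn (fun M hM => (hc hM).2.1)
        (fun M hM => hE.of_isClosed_subset (hc hM).2.2.1 (hc hM).1) (fun M hM => (hc hM).2.2.1)
    · exact fun s p hp M hM => (hc hM).2.2.2 s p (hp M hM)) E hmem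
  exact ⟨M, hM⟩

/-- A minimal set of the skew product flow meets every fibre in at most one point: the translations
along the fibres that preserve it would otherwise make it unbounded. -/
theorem eq_of_mem_minimal {E M : Set (C(ℝ, B) × B)} (hE : IsCompact E)
    (hM : Minimal (· ∈ skewInvariantSubsets E) M) {ψ : C(ℝ, B)} {x y : B}
    (hx : (ψ, x) ∈ M) (hy : (ψ, y) ∈ M) : x = y := by
  obtain ⟨hME, -, hMclosed, hMinv⟩ := hM.prop
  set v : B := y - x with hv
  have hcont : Continuous fun p : C(ℝ, B) × B => (p.1, p.2 + v) := by fun_prop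
  -- Translation by `v` along the fibres commutes with the flow, so this subset is invariant and
  -- minimality makes it all of `M`.
  have hN : M ∩ {p | (p.1, p.2 + v) ∈ M} ∈ skewInvariantSubsets E := by
    refine ⟨Set.inter_subset_left.trans hME, ⟨(ψ, x), hx, by simpa [hv] using hy⟩,
      hMclosed.inter (hMclosed.preimage hcont), fun s p hp => ⟨hMinv s p hp.1, ?_⟩⟩
    have := hMinv s _ hp.2
    simpa only [skewShift, Set.mem_ofPred_eq, add_right_comm] using this
  have hstep : ∀ p ∈ M, (p.1, p.2 + v) ∈ M := fun p hp =>
    (hM.le_of_le hN Set.inter_subset_left hp).2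
  have hiter (n : ℕ) : (ψ, x + n • v) ∈ M := by
    induction n with
    | zero => simpa using hx
    | succ n ih => simpa [succ_nsmul, add_assoc] using hstep _ ih
  obtain ⟨C, hC⟩ := (hE.image continuous_snd).isBounded.exists_norm_le
  have hbound (n : ℕ) : n * ‖v‖ ≤ C + ‖x‖ := by
    have h1 : ‖x + n • v‖ ≤ C := hC _ ⟨_, hME (hiter n), rfl⟩
    have h2 : ‖n • v‖ = n * ‖v‖ := by
      rw [← Nat.cast_smul_eq_nsmul ℝ, norm_smul, Real.norm_natCast]
    have h3 : ‖n • v‖ ≤ ‖x + n • v‖ + ‖x‖ := by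
      simpa using norm_sub_le (x + n • v) x
    linarith
  by_contra hne
  have hpos : 0 < ‖v‖ := norm_pos_iff.2 (sub_ne_zero.2 (Ne.symm hne))
  obtain ⟨n, hn⟩ := exists_nat_gt ((C + ‖x‖) / ‖v‖)
  exact absurd (hbound n) (not_le.2 ((div_lt_iff₀ hpos).1 hn))

/-- The increment of the primitive is `primitive (shift t φ) τ`. Were it at least `ε` for
arbitrarily large `t`, a cluster point of those shifts would be an ω-limit point violating `h`. -/
theorem eventually_norm_primitive_sub_lt {φ : C(ℝ, B)} (hφ : PositivelyLagrangeStable φ)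
    {τ ε : ℝ} (h : ∀ ψ ∈ omegaLimitSet φ, ‖primitive ψ τ‖ < ε) :
    ∀ᶠ t in atTop, ‖primitive φ (t + τ) - primitive φ t‖ < ε := by
  by_contra hcon
  have hfreq := (not_eventually.1 hcon).and_eventually (eventually_ge_atTop 0)
  have hK : IsCompact (closure {ψ : C(ℝ, B) | ∃ h : ℝ, 0 ≤ h ∧ ψ = shift h φ} ∩
      {ψ | ε ≤ ‖primitive ψ τ‖}) :=
    IsCompact.inter_right hφ (isClosed_le continuous_const (continuous_primitive_apply τ).norm)
  obtain ⟨ψ, hψ, hcl⟩ := hK.exists_mapClusterPt_of_frequently (f := fun t => shift t φ)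
    (hfreq.mono fun t ht => ⟨subset_closure ⟨t, ht.2, rfl⟩, by
      simpa only [Set.mem_ofPred_eq, primitive_shift, not_lt] using ht.1⟩)
  exact absurd (h ψ (mem_omegaLimitSet_of_mapClusterPt hcl)) (not_lt.2 hψ.2)

/-- Over a minimal `ω`-limit set, a precompact primitive inherits every remote almost period. -/
theorem exists_eventually_norm_primitive_sub_lt {φ : C(ℝ, B)} (hφ : PositivelyLagrangeStable φ)
    (hmin : IsMinimalShiftSet (omegaLimitSet φ))
    (hF : IsCompact (closure (primitive φ '' Set.Ici (0 : ℝ)))) {ε : ℝ} (hε : 0 < ε) :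
    ∃ δ : ℝ, 0 < δ ∧ ∀ τ : ℝ, (∀ᶠ t in atTop, ‖φ (t + τ) - φ t‖ ≤ δ) →
      ∀ᶠ t in atTop, ‖primitive φ (t + τ) - primitive φ t‖ < ε := by
  -- The ω-limit set of the skew product trajectory.
  set E : Set (C(ℝ, B) × B) := {p | MapClusterPt p atTop (skewOrbit φ)} with hEdef
  have hK := IsCompact.prod hφ hF
  have horbit : ∀ᶠ t in atTop, skewOrbit φ t ∈
      closure {ψ : C(ℝ, B) | ∃ h : ℝ, 0 ≤ h ∧ ψ = shift h φ} ×ˢ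
        closure (primitive φ '' Set.Ici (0 : ℝ)) := by
    filter_upwards [eventually_ge_atTop 0] with t ht
    exact ⟨subset_closure ⟨t, ht, rfl⟩, subset_closure ⟨t, ht, rfl⟩⟩
  have hEclosed : IsClosed E := isClosed_setOfPred_clusterPt
  have hE : IsCompact E := hK.of_isClosed_subset hEclosed fun p hp =>
    hK.isClosed.mem_of_mapClusterPt hp horbit
  have hEmem : E ∈ skewInvariantSubsets E := by
    obtain ⟨p, -, hp⟩ := hK.exists_mapClusterPt_of_frequently horbit.frequently
    exact ⟨subset_rfl, ⟨p, hp⟩, hEclosed, fun s p hp => mapClusterPt_skewShift hp s⟩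
  obtain ⟨M, hM⟩ := exists_minimal_skewInvariantSubsets hE hEmem
  obtain ⟨hME, hMne, hMclosed, hMinv⟩ := hM.prop
  have hMcompact : IsCompact M := hE.of_isClosed_subset hMclosed hME
  -- The projection is a nonempty, closed, invariant subset of the minimal set `omegaLimitSet φ`.
  have hproj : Prod.fst '' M = omegaLimitSet φ := by
    refine hmin.2.2.2 _ ?_ (hMne.image _) (hMcompact.image continuous_fst).isClosed
      (shiftInvariant_of_forall_mem ?_)
    · rintro _ ⟨p, hp, rfl⟩
      exact mem_omegaLimitSet_of_mapClusterPt
        ((hME hp).continuousAt_comp continuous_fst.continuousAt)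
    · rintro s _ ⟨p, hp, rfl⟩
      exact ⟨_, hMinv s p hp, rfl⟩
  obtain ⟨δ, hδ, hδM⟩ := exists_norm_sub_lt_of_graph hMcompact
    (fun _ _ _ => eq_of_mem_minimal hE hM) hε
  refine ⟨δ, hδ, fun τ hτ => eventually_norm_primitive_sub_lt hφ fun ψ hψ => ?_⟩
  have hψ' := hψ
  rw [← hproj] at hψ'
  obtain ⟨p, hp, rfl⟩ := hψ'
  -- The points `skewShift τ p` and `p` of `M` have second components differing by exactly
  -- `primitive p.1 τ`.
  simpa [skewShift] using hδM _ (hMinv τ p hp) _ hp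
    fun t => norm_sub_le_of_mem_omegaLimitSet hψ hτ t

theorem PositivelyRemotelyAlmostPeriodic.primitive {φ : C(ℝ, B)}
    (hφ : PositivelyLagrangeStable φ) (hmin : IsMinimalShiftSet (omegaLimitSet φ))
    (hF : IsCompact (closure (primitive φ '' Set.Ici (0 : ℝ))))
    (h : PositivelyRemotelyAlmostPeriodic φ) :
    PositivelyRemotelyAlmostPeriodic (RemotelyAP.primitive φ) := by
  intro ε hε
  obtain ⟨δ, hδ, hτ⟩ := exists_eventually_norm_primitive_sub_lt hφ hmin hF hε
  obtain ⟨P, hP, hPφ⟩ := h δ hδ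
  refine ⟨P, hP, fun τ hτP => ?_⟩
  obtain ⟨L, -, hL⟩ := hPφ τ hτP
  obtain ⟨N, hN⟩ := eventually_atTop.1
    (hτ τ ((eventually_ge_atTop L).mono fun t ht => (hL t ht).le))
  exact ⟨max N 1, by positivity, fun t ht => hN t ((le_max_left _ _).trans ht)⟩

theorem PositivelyRemotelyPeriodic.primitive {φ : C(ℝ, B)}
    (hφ : PositivelyLagrangeStable φ) (hmin : IsMinimalShiftSet (omegaLimitSet φ))
    (hF : IsCompact (closure (primitive φ '' Set.Ici (0 : ℝ)))) {τ : ℝ}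
    (h : PositivelyRemotelyPeriodic τ φ) :
    PositivelyRemotelyPeriodic τ (RemotelyAP.primitive φ) := by
  refine tendsto_order.2 ⟨fun a ha => Eventually.of_forall fun t => ha.trans_le (norm_nonneg _),
    fun ε hε => ?_⟩
  obtain ⟨δ, hδ, hτ⟩ := exists_eventually_norm_primitive_sub_lt hφ hmin hF hε
  exact hτ τ (h.eventually_le_const hδ)

end SkewShift

end RemotelyAP

end

theorem corollary3p8 {B : Type*} [NormedAddCommGroup B] [NormedSpace ℝ B] [CompleteSpace B]
    (φ : C(ℝ, B))
    (hLagrange : RemotelyAP.PositivelyLagrangeStable φ)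
    (hMinimal : RemotelyAP.IsMinimalShiftSet (RemotelyAP.omegaLimitSet φ))
    (hPrecompact : IsCompact (closure (RemotelyAP.primitive φ '' Set.Ici (0 : ℝ)))) :
    (RemotelyAP.PositivelyRemotelyAlmostPeriodic φ →
      RemotelyAP.PositivelyRemotelyAlmostPeriodic (RemotelyAP.primitive φ)) ∧
    (∀ τ : ℝ, 0 < τ → RemotelyAP.PositivelyRemotelyPeriodic τ φ →
      RemotelyAP.PositivelyRemotelyPeriodic τ (RemotelyAP.primitive φ)) ∧
    (RemotelyAP.PositivelyRemotelyStationary φ →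
      RemotelyAP.PositivelyRemotelyStationary (RemotelyAP.primitive φ)) :=
  ⟨fun h => h.primitive hLagrange hMinimal hPrecompact,
    fun _ _ h => h.primitive hLagrange hMinimal hPrecompact,
    fun h τ hτ => (h τ hτ).primitive hLagrange hMinimal hPrecompact⟩
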